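/- Let $\mathfrak A$ be a $C^*$-algebra (not necessarily unital), let $H$ be a Hilbert $\mathfrak A$-module, and let $\mathcal L(H)$ be the $C^*$-algebra of adjointable operators on $H$, with identity $I$; write $\mathcal R(T)$ for the range of $T$ and $|T|=(T^*T)^{1/2}$. A pair $(P,Q)$ is a \emph{quasi-projection pair} on $H$ if $P\in\mathcal L(H)$ is a projection ($P=P^*=P^2$) and $Q\in\mathcal L(H)$ is an idempotent ($Q^2=Q$) such that $$PQ^*P=PQP,\quad PQ^*(I-P)=-PQ(I-P),\quad (I-P)Q^*(I-P)=(I-P)Q(I-P).$$ An operator $T\in\mathcal L(H)$ \emph{has the polar decomposition} if there is a partial isometry $U\in\mathcal L(H)$ such that $T=U|T|$ and $U^*U$ is the projection of $H$ onto $\overline{\mathcal R(T^*)}$. A quasi-projection pair $(P,Q)$ is \emph{semi-harmonious} if both $T_1=P(I-Q)$ and $T_2=(I-P)Q$ have the polar decomposition. Theorem. Let $(P,Q)$ be a quasi-projection pair on $H$, let $T_1=P(I-Q)$, $T_2=(I-P)Q$, and let $$M=\overline{\mathcal R(T_1)}+\overline{\mathcal R(T_2)}.$$ Then $M=\overline{\mathcal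 R(P-Q)}$; $M$ is a closed submodule of $H$ (hence itself a Hilbert $\mathfrak A$-module); $P$ and $Q$ map $M$ into $M$, and their restrictions $P|_M$, $Q|_M$ belong to $\mathcal L(M)$; and $(P|_M,Q|_M)$ is a semi-harmonious quasi-projection pair on $M$. -/

import Mathlib

/-! ### Adjointable operators on a Hilbert `C⋆`-module -/

section Adjointable

variable (A E : Type*) [NonUnitalCStarAlgebra A] [PartialOrder A]
  [NormedAddCommGroup E] [NormedSpace ℂ E] [SMul A E] [CStarModule A E]

/-- The algebra `𝓛(E)` of adjointable operators on the (pre-)Hilbert `C⋆`-module `E` over `A`: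
the bounded operators `T` that have an adjoint `S`, i.e. `⟪T x, y⟫ = ⟪x, S y⟫` for the `A`-valued
inner product. (Such operators are automatically `A`-linear, see `Adjointable.map_smul`.) -/
def adjointableSubalgebra : Subalgebra ℂ (E →L[ℂ] E) where
  carrier := {T | ∃ S : E →L[ℂ] E, ∀ x y : E, inner A (T x) y = inner A x (S y)}
  mul_mem' := by
    rintro T₁ T₂ ⟨S₁, h₁⟩ ⟨S₂, h₂⟩
    exact ⟨S₂ * S₁, fun x y => by simp [h₁, h₂]⟩
  add_mem' := by
    rintro T₁ T₂ ⟨S₁, h₁⟩ ⟨S₂, h₂⟩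
    exact ⟨S₁ + S₂, fun x y => by simp [h₁, h₂]⟩
  algebraMap_mem' := fun c =>
    ⟨star c • 1, fun x y => by
      simp [Algebra.algebraMap_eq_smul_one, CStarModule.inner_smul_left_complex]⟩

/-- The type `𝓛(E)` of adjointable operators on `E`; as a normed algebra it is a subalgebra of the
bounded operators on `E`. -/
def Adjointable : Type _ := ↥(adjointableSubalgebra A E)

variable {A E}

/-- Two vectors with the same inner products against all vectors agree. -/
theorem CStarModule.eq_of_inner_left_eq {y z : E}
    (h : ∀ x : E, inner A x y = inner A x z) : y = z := by
  rw [← sub_eq_zero, ← CStarModule.inner_self (A := A), CStarModule.inner_sub_right, h, sub_self]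

namespace Adjointable

noncomputable instance instNormedRing : NormedRing (Adjointable A E) :=
  inferInstanceAs (NormedRing ↥(adjointableSubalgebra A E))

noncomputable instance instNormedAlgebra : NormedAlgebra ℂ (Adjointable A E) :=
  inferInstanceAs (NormedAlgebra ℂ ↥(adjointableSubalgebra A E))

/-- The underlying bounded operator. -/
def toCLM (T : Adjointable A E) : E →L[ℂ] E := Subtype.val T

theorem toCLM_injective : Function.Injective (toCLM : Adjointable A E → (E →L[ℂ] E)) :=
  Subtype.val_injective

instance instFunLike : FunLike (Adjointable A E) E E where
  coe T := T.toCLM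
  coe_injective _ _ h := toCLM_injective (DFunLike.coe_injective h)

@[ext]
theorem ext {T S : Adjointable A E} (h : ∀ x, T x = S x) : T = S := DFunLike.ext T S h

@[simp] theorem toCLM_apply (T : Adjointable A E) (x : E) : T.toCLM x = T x := rfl
@[simp] theorem add_apply (T S : Adjointable A E) (x : E) : (T + S) x = T x + S x := rfl
@[simp] theorem sub_apply (T S : Adjointable A E) (x : E) : (T - S) x = T x - S x := rfl
@[simp] theorem neg_apply (T : Adjointable A E) (x : E) : (-T) x = -T x := rfl
@[simp] theorem mul_apply (T S : Adjointable A E) (x : E) : (T * S) x = T (S x) := rfl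
@[simp] theorem zero_apply (x : E) : (0 : Adjointable A E) x = 0 := rfl
@[simp] theorem one_apply (x : E) : (1 : Adjointable A E) x = x := rfl
@[simp] theorem smul_apply (c : ℂ) (T : Adjointable A E) (x : E) : (c • T) x = c • T x := rfl
theorem norm_def (T : Adjointable A E) : ‖T‖ = ‖T.toCLM‖ := rfl
theorem isometry_toCLM : Isometry (toCLM : Adjointable A E → (E →L[ℂ] E)) := fun _ _ => rfl

/-- The adjoint `T⋆`. -/
noncomputable instance instStar : Star (Adjointable A E) where
  star T := ⟨Classical.choose T.2, T.1, fun x y => by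
    rw [← CStarModule.star_inner, ← Classical.choose_spec T.2, CStarModule.star_inner]⟩

/-- The defining property of the adjoint. -/
theorem inner_apply_left (T : Adjointable A E) (x y : E) :
    inner A (T x) y = inner A x (star T y) :=
  Classical.choose_spec T.2 x y

/-- The adjoint is determined by its defining property. -/
theorem star_eq_of_inner {T S : Adjointable A E}
    (h : ∀ x y : E, inner A (T x) y = inner A x (S y)) : star T = S := by
  ext y
  exact CStarModule.eq_of_inner_left_eq (A := A) fun x => by rw [← inner_apply_left, h]

theorem inner_apply_right (T : Adjointable A E) (x y : E) :
    inner A x (T y) = inner A (star T x) y := by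
  rw [← CStarModule.star_inner, inner_apply_left, CStarModule.star_inner]

/-- Adjointable operators are `A`-linear. -/
theorem map_smul (T : Adjointable A E) (a : A) (x : E) : T (a • x) = a • T x := by
  refine CStarModule.eq_of_inner_left_eq (A := A) fun z => ?_
  rw [inner_apply_right, CStarModule.inner_op_smul_right, CStarModule.inner_op_smul_right,
    inner_apply_right]

noncomputable instance instStarRing : StarRing (Adjointable A E) where
  star_involutive T := star_eq_of_inner fun x y => (inner_apply_right T x y).symm
  star_mul T S := star_eq_of_inner fun x y => by simp [inner_apply_left]
  star_add T S := star_eq_of_inner fun x y => by simp [inner_apply_left]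

instance instStarModule : StarModule ℂ (Adjointable A E) where
  star_smul c T := star_eq_of_inner fun x y => by simp [inner_apply_left]

variable [StarOrderedRing A]

theorem norm_sq_apply_le (T : Adjointable A E) (x : E) :
    ‖T x‖ ^ 2 ≤ ‖star T * T‖ * ‖x‖ ^ 2 := by
  rw [CStarModule.norm_sq_eq (A := A), inner_apply_left]
  refine (CStarModule.norm_inner_le E).trans ?_
  have : ‖star T (T x)‖ ≤ ‖star T * T‖ * ‖x‖ := (star T * T).toCLM.le_opNorm x
  calc ‖x‖ * ‖star T (T x)‖ ≤ ‖x‖ * (‖star T * T‖ * ‖x‖) := by gcongr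
    _ = _ := by ring

instance instCStarRing : CStarRing (Adjointable A E) where
  norm_mul_self_le T := by
    have h : ‖T‖ ≤ √‖star T * T‖ := by
      refine ContinuousLinearMap.opNorm_le_bound _ (Real.sqrt_nonneg _) fun x => ?_
      refine (sq_le_sq₀ (norm_nonneg _) (by positivity)).mp ?_
      rw [mul_pow, Real.sq_sqrt (norm_nonneg _)]
      exact norm_sq_apply_le T x
    calc ‖T‖ * ‖T‖ ≤ √‖star T * T‖ * √‖star T * T‖ := by gcongr
      _ = _ := Real.mul_self_sqrt (norm_nonneg _)

instance instCompleteSpace [CompleteSpace E] : CompleteSpace (Adjointable A E) := by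
  refine Metric.complete_of_cauchySeq_tendsto fun u hu => ?_
  have hv : CauchySeq fun n => star (u n) := by
    rw [Metric.cauchySeq_iff] at hu ⊢
    intro ε hε
    obtain ⟨N, hN⟩ := hu ε hε
    refine ⟨N, fun m hm n hn => ?_⟩
    rw [dist_eq_norm, ← star_sub, norm_star, ← dist_eq_norm]
    exact hN m hm n hn
  have hval := (isometry_toCLM (A := A) (E := E)).uniformContinuous
  obtain ⟨T, hT⟩ := cauchySeq_tendsto_of_complete (hval.comp_cauchySeq hu)
  obtain ⟨S, hS⟩ := cauchySeq_tendsto_of_complete (hval.comp_cauchySeq hv)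
  refine ⟨⟨T, S, fun x y => ?_⟩,
    (isometry_toCLM (A := A) (E := E)).isUniformInducing.isInducing.tendsto_nhds_iff.mpr hT⟩
  have hTx := ((ContinuousLinearMap.apply ℂ E x).continuous.tendsto T).comp hT
  have hSy := ((ContinuousLinearMap.apply ℂ E y).continuous.tendsto S).comp hS
  have h₁ := ((CStarModule.continuous_inner (A := A)).tendsto (T x, y)).comp
    (hTx.prodMk_nhds tendsto_const_nhds)
  have h₂ := ((CStarModule.continuous_inner (A := A)).tendsto (x, S y)).comp
    ((tendsto_const_nhds (x := x)).prodMk_nhds hSy)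
  refine tendsto_nhds_unique h₁ (h₂.congr fun n => ?_)
  exact (inner_apply_left (u n) x y).symm

noncomputable instance instCStarAlgebra [CompleteSpace E] : CStarAlgebra (Adjointable A E) where

/-- The usual order on the `C⋆`-algebra `𝓛(E)`: `S ≤ T` iff `T - S` is positive, i.e. self-adjoint
with non-negative spectrum. -/
noncomputable instance instPartialOrder [CompleteSpace E] : PartialOrder (Adjointable A E) :=
  CStarAlgebra.spectralOrder _

instance instStarOrderedRing [CompleteSpace E] : StarOrderedRing (Adjointable A E) :=
  CStarAlgebra.spectralOrderedRing _

end Adjointable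

/-! ### Polar decomposition and quasi-projection pairs -/

/-- The range `𝓡(T)` of an adjointable operator. -/
def opRange (T : Adjointable A E) : Set E := Set.range T

/-- `p` is the projection `P_M`: a projection with range `M`. (It exists precisely when the
closed submodule `M` is orthogonally complemented, and is then unique.) -/
def IsProjectionOnto (p : Adjointable A E) (M : Set E) : Prop :=
  IsStarProjection p ∧ opRange p = M

/-- `T` has the polar decomposition: there is a partial isometry `U` with `T = U |T|` and
`U⋆ U` the projection onto the closure of `𝓡(T⋆)`; here `|T| = (T⋆ T)^{1/2}`. -/
def HasPolarDecomposition [StarOrderedRing A] [CompleteSpace E] (T : Adjointable A E) : Prop :=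
  ∃ U : Adjointable A E, U * star U * U = U ∧ T = U * CFC.abs T ∧
    IsProjectionOnto (star U * U) (closure (opRange (star T)))

/-- Quasi-projection pairs: `P` is a projection, `Q` is an idempotent, and the compressions of `Q⋆`
and `Q` by `P` and `1 - P` are related by the three identities. -/
structure IsQuasiProjectionPair (P Q : Adjointable A E) : Prop where
  isStarProjection : IsStarProjection P
  isIdempotentElem : IsIdempotentElem Q
  corner : P * star Q * P = P * Q * P
  off_diagonal : P * star Q * (1 - P) = -(P * Q * (1 - P))
  co_corner : (1 - P) * star Q * (1 - P) = (1 - P) * Q * (1 - P)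

/-- The quasi-projection pair `(P, Q)` is semi-harmonious: `P (1 - Q)` and `(1 - P) Q` both
have the polar decomposition. -/
structure IsSemiHarmoniousPair [StarOrderedRing A] [CompleteSpace E]
    (P Q : Adjointable A E) : Prop where
  isQuasiProjectionPair : IsQuasiProjectionPair P Q
  polar_fst : HasPolarDecomposition (P * (1 - Q))
  polar_snd : HasPolarDecomposition ((1 - P) * Q)

end Adjointable

/-! ### Closed submodules as Hilbert `C⋆`-modules -/

section HilbertSubmodule

/-- Closed submodules of the Hilbert `C⋆`-module `E` over `A`: norm closed complex subspaces that
are invariant under the action of `A`. -/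
structure HilbertSubmodule (A E : Type*) [NormedAddCommGroup E] [NormedSpace ℂ E] [SMul A E]
    extends Submodule ℂ E where
  algebra_smul_mem' : ∀ (a : A) {x : E}, x ∈ carrier → a • x ∈ carrier
  isClosed' : IsClosed carrier

variable {A E : Type*} [NonUnitalCStarAlgebra A] [PartialOrder A]
  [NormedAddCommGroup E] [NormedSpace ℂ E] [SMul A E] [CStarModule A E]

instance HilbertSubmodule.instSMul (M : HilbertSubmodule A E) : SMul A M.toSubmodule where
  smul a x := ⟨a • (x : E), M.algebra_smul_mem' a x.2⟩

instance HilbertSubmodule.instCompleteSpace [CompleteSpace E] (M : HilbertSubmodule A E) :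
    CompleteSpace M.toSubmodule :=
  M.isClosed'.completeSpace_coe

/-- A closed submodule is a Hilbert `C⋆`-module under the restricted operations. -/
instance HilbertSubmodule.instCStarModule (M : HilbertSubmodule A E) :
    CStarModule A M.toSubmodule where
  inner x y := inner A (x : E) (y : E)
  inner_add_right := CStarModule.inner_add_right
  inner_self_nonneg := CStarModule.inner_self_nonneg
  inner_self := CStarModule.inner_self.trans Submodule.coe_eq_zero
  inner_op_smul_right := CStarModule.inner_op_smul_right
  inner_smul_right_complex := CStarModule.inner_smul_right_complex
  star_inner _ _ := CStarModule.star_inner _ _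
  norm_eq_sqrt_norm_inner_self x := CStarModule.norm_eq_sqrt_norm_inner_self (A := A) (x : E)

/-- The operator `T'` on the closed submodule `M` is the restriction `T|_M` of `T`. -/
def IsRestriction {M : HilbertSubmodule A E} (T : Adjointable A E)
    (T' : Adjointable A M.toSubmodule) : Prop :=
  ∀ x : M.toSubmodule, ((T' x : M.toSubmodule) : E) = T (x : E)

end HilbertSubmodule

/-! Everything runs through `D = (P - Q)²`. For any two idempotents, `D` commutes with both. The
quasi-projection identities say exactly that `Q⋆ = J Q J` for the symmetry `J = 2P - 1`, and this
makes `D` self-adjoint and gives `(P - Q)(P - Q)⋆ = D (1 - 2Q) J`. Since `𝓡(T)` lies in the closure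
of `𝓡(T T⋆)`, the ranges of `P - Q` and `D` have the same closure `M`, which `P`, `Q` and their
adjoints therefore preserve. Splitting by `P` and `1 - P` yields the sum formula.

On `M` the restriction of `D` has dense range. There `P(1 - Q)P = P D` makes `𝓡(T₁)` dense in
`𝓡(P)`, and the adjoint of `(1 - Q)P(1 - Q) = D(1 - Q)` makes `𝓡(T₁⋆)` dense in the range of the
idempotent `(1 - Q)⋆`. Both closures are ranges of projections, which suffices for a polar
decomposition; `T₂` follows by passing to `(1 - P, 1 - Q)`. -/

/-! ### Functional calculus and idempotents in a `C⋆`-algebra -/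

section ResolventAndIdempotents

variable {B : Type*} [CStarAlgebra B] [PartialOrder B] [StarOrderedRing B]

/-- Every element `T` of a `C⋆`-algebra is a norm limit of elements `T T⋆ R`. -/
theorem exists_norm_sub_mul_star_mul_le (T : B) {t : ℝ} (ht : 0 < t) :
    ∃ R : B, ‖T - T * star T * R‖ ^ 2 ≤ t := by
  set h : B := T * star T with hh
  have h0 : 0 ≤ h := mul_star_self_nonneg T
  have hsa : IsSelfAdjoint h := .of_nonneg h0
  have hspec : ∀ x ∈ spectrum ℝ h, 0 ≤ x := fun x hx => spectrum_nonneg_of_nonneg h0 hx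
  have hc : ContinuousOn (fun x : ℝ => (x + t)⁻¹) (spectrum ℝ h) :=
    ContinuousOn.inv₀ (by fun_prop) fun x hx => by have := hspec x hx; positivity
  have hc' : ContinuousOn (fun x : ℝ => t * (x + t)⁻¹) (spectrum ℝ h) := by fun_prop
  have hid : ContinuousOn (fun x : ℝ => x) (spectrum ℝ h) := by fun_prop
  -- With `R = (h + t)⁻¹ T` the error is `k T`, `k = t (h + t)⁻¹`, and `‖k T‖² = ‖k h k‖` is bounded
  -- by the supremum of `t² x / (x + t)² ≤ t` over `x ≥ 0`.
  set r : B := cfc (fun x : ℝ => (x + t)⁻¹) h with hr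
  set k : B := cfc (fun x : ℝ => t * (x + t)⁻¹) h with hk
  have hhr : 1 - h * r = k := by
    rw [sub_eq_iff_eq_add]
    have e1 : h * r = cfc (fun x : ℝ => x * (x + t)⁻¹) h := by
      rw [cfc_mul (fun x : ℝ => x) (fun x => (x + t)⁻¹) h hid hc, cfc_id' ℝ h]
    rw [e1, hk, ← cfc_add (a := h) _ (fun x : ℝ => x * (x + t)⁻¹) hc' (by fun_prop), ← cfc_one ℝ h]
    refine cfc_congr fun x hx => ?_
    have := hspec x hx
    simp only [Pi.one_apply]
    field_simp
    ring
  have hksa : star k = k := (cfc_predicate (fun x : ℝ => t * (x + t)⁻¹) h : IsSelfAdjoint _)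
  refine ⟨r * T, ?_⟩
  have e2 : T - h * (r * T) = k * T := by rw [← hhr]; noncomm_ring
  rw [e2, sq, ← CStarRing.norm_self_mul_star, star_mul, hksa]
  have e3 : k * T * (star T * k)
      = cfc (fun x : ℝ => t * (x + t)⁻¹ * x * (t * (x + t)⁻¹)) h := by
    rw [cfc_mul (fun x : ℝ => t * (x + t)⁻¹ * x) _ h (by fun_prop) hc', cfc_mul _ _ h hc' hid,
      cfc_id' ℝ h, ← hk, hh]
    noncomm_ring
  rw [e3]
  refine norm_cfc_le ht.le fun x hx => ?_
  have hx0 := hspec x hx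
  have hxt : 0 < x + t := by positivity
  rw [Real.norm_of_nonneg (by positivity)]
  have e4 : t * (x + t)⁻¹ * x * (t * (x + t)⁻¹) = t * (t * x / (x + t) ^ 2) := by field_simp
  rw [e4]
  refine mul_le_of_le_one_right ht.le ?_
  rw [div_le_one (by positivity)]
  nlinarith [mul_nonneg hx0 ht.le, sq_nonneg x, sq_nonneg t]

/-- An idempotent of a `C⋆`-algebra has the same range as some projection. -/
theorem exists_isStarProjection_of_isIdempotentElem {e : B} (he : IsIdempotentElem e) :
    ∃ p : B, IsStarProjection p ∧ p * e = e ∧ e * p = p := by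
  have he2 : e * e = e := he
  have hs2 : star e * star e = star e := by rw [← star_mul, he2]
  have hr : ∀ x, e * (e * x) = e * x := fun x => by rw [← mul_assoc, he2]
  -- Kaplansky's trick: `w ≥ 1` is invertible and commutes with `e` and `e⋆`, and `e w = e e⋆ e`, so
  -- `e e⋆ w⁻¹` is the required projection.
  set w : B := 1 + (e - star e) * star (e - star e) with hw
  have hu : IsUnit w := by
    refine CStarAlgebra.isUnit_of_le 1 ?_
    rw [hw]
    exact le_add_of_nonneg_right (mul_star_self_nonneg _)
  have hwe : e * w = e * star e * e := by
    simp only [hw, star_sub, star_star, mul_add, mul_sub, sub_mul, mul_assoc, mul_one, he2, hs2, hr]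
    abel
  have hew : w * e = e * star e * e := by
    simp only [hw, star_sub, star_star, add_mul, mul_sub, sub_mul, mul_assoc, one_mul, he2, hs2]
    abel
  have hwsa : star w = w := by simp [hw]
  obtain ⟨u, hu⟩ := hu
  have hce : Commute e (↑u : B) := by rw [hu]; exact hwe.trans hew.symm
  have hcs : Commute (star e) (↑u : B) := by
    have := hce.star_star
    rwa [hu, hwsa, ← hu] at this
  have hcei : Commute e (↑u⁻¹ : B) := hce.units_inv_right
  have hcsi : Commute (star e) (↑u⁻¹ : B) := hcs.units_inv_right
  have hui : star (↑u⁻¹ : B) = ↑u⁻¹ := by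
    have h1 : star (↑u⁻¹ : B) * ↑u = 1 := by
      have := congrArg star (Units.mul_inv u)
      rwa [star_mul, star_one, hu, hwsa, ← hu] at this
    calc star (↑u⁻¹ : B) = star (↑u⁻¹ : B) * (↑u * ↑u⁻¹) := by rw [Units.mul_inv, mul_one]
      _ = ↑u⁻¹ := by rw [← mul_assoc, h1, one_mul]
  have hpe : e * star e * ↑u⁻¹ * e = e := by
    rw [mul_assoc, ← hcei.eq, ← mul_assoc, ← hwe, ← hu, mul_assoc, Units.mul_inv, mul_one]
  have hep : e * (e * star e * ↑u⁻¹) = e * star e * ↑u⁻¹ := by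
    simp only [mul_assoc, hr]
  refine ⟨e * star e * ↑u⁻¹, ⟨?_, ?_⟩, hpe, hep⟩
  · change _ * _ = _
    calc e * star e * ↑u⁻¹ * (e * star e * ↑u⁻¹)
        = e * star e * ↑u⁻¹ * e * (star e * ↑u⁻¹) := by noncomm_ring
      _ = _ := by rw [hpe, mul_assoc]
  · change star _ = _
    rw [star_mul, star_mul, star_star, hui]
    exact ((hcei.mul_left hcsi).eq).symm

end ResolventAndIdempotents

/-! ### Ranges, projections and extension by density -/

namespace Adjointable

variable {A E : Type*} [NonUnitalCStarAlgebra A] [PartialOrder A]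
  [NormedAddCommGroup E] [NormedSpace ℂ E] [SMul A E] [CStarModule A E]

theorem continuous (T : Adjointable A E) : Continuous T := T.toCLM.continuous

theorem map_add (T : Adjointable A E) (x y : E) : T (x + y) = T x + T y := T.toCLM.map_add x y

theorem map_sub (T : Adjointable A E) (x y : E) : T (x - y) = T x - T y := T.toCLM.map_sub x y

theorem norm_apply_le (T : Adjointable A E) (x : E) : ‖T x‖ ≤ ‖T‖ * ‖x‖ := T.toCLM.le_opNorm x

theorem apply_apply_of_mul_eq {R S T : Adjointable A E} (h : R * S = T) (x : E) :
    R (S x) = T x := by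
  rw [← h, mul_apply]

/-- An operator that maps `𝓡(R)` into `𝓡(S)` maps the closure of `𝓡(R)` into that of `𝓡(S)`. -/
theorem apply_mem_closure_opRange {T R S : Adjointable A E} (h : ∀ y, ∃ z, S z = T (R y))
    {x : E} (hx : x ∈ closure (opRange R)) : T x ∈ closure (opRange S) := by
  refine map_mem_closure T.continuous hx ?_
  rintro _ ⟨y, rfl⟩
  exact h y

theorem mem_opRange_iff_of_isIdempotentElem {e : Adjointable A E} (he : IsIdempotentElem e)
    {x : E} : x ∈ opRange e ↔ e x = x := by
  refine ⟨?_, fun h => ⟨x, h⟩⟩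
  rintro ⟨y, rfl⟩
  exact apply_apply_of_mul_eq he y

theorem isClosed_opRange_of_isIdempotentElem {e : Adjointable A E} (he : IsIdempotentElem e) :
    IsClosed (opRange e) := by
  have : opRange e = {x | e x = x} := Set.ext fun x => mem_opRange_iff_of_isIdempotentElem he
  rw [this]
  exact isClosed_eq e.continuous continuous_id

variable {X Y p : Adjointable A E}

/-- In `z = p z + (1 - p) z` the first term is a limit of vectors `X u`. Operators can thus be
defined and compared on vectors `X u + (1 - p) v`. -/
theorem denseRange_apply_add_apply_one_sub (hp : IsProjectionOnto p (closure (opRange X))) :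
    DenseRange fun v : E × E => X v.1 + (1 - p) v.2 := by
  intro z
  have h : ∀ x ∈ closure (opRange X),
      x + (1 - p) z ∈ closure (Set.range fun v : E × E => X v.1 + (1 - p) v.2) := by
    intro x hx
    refine closure_minimal
      (t := (fun x => x + (1 - p) z) ⁻¹' closure (Set.range fun v : E × E => X v.1 + (1 - p) v.2))
      ?_ (isClosed_closure.preimage (by fun_prop)) hx
    rintro _ ⟨y, rfl⟩
    exact subset_closure ⟨(y, z), rfl⟩
  have := h (p z) (hp.2 ▸ ⟨z, rfl⟩)
  simpa using this

theorem mul_eq_of_isProjectionOnto (hp : IsProjectionOnto p (closure (opRange X))) :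
    p * X = X := by
  ext x
  refine (mem_opRange_iff_of_isIdempotentElem hp.1.isIdempotentElem).1 ?_
  rw [hp.2]
  exact subset_closure ⟨x, rfl⟩

theorem norm_apply_eq_of_star_mul_self_eq (h : star X * X = star Y * Y) (x : E) :
    ‖Y x‖ = ‖X x‖ := by
  have : inner A (X x) (X x) = inner A (Y x) (Y x) := by
    rw [inner_apply_left, inner_apply_left, ← mul_apply, ← mul_apply, h]
  rw [CStarModule.norm_eq_sqrt_norm_inner_self (A := A), ← this,
    ← CStarModule.norm_eq_sqrt_norm_inner_self (A := A)]

/-- Operators agree when they agree on `𝓡(X)` and on the complement of its closure. -/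
theorem eq_of_mul_eq_of_mul_one_sub_eq {S T : Adjointable A E}
    (hp : IsProjectionOnto p (closure (opRange X)))
    (h : S * X = T * X) (h' : S * (1 - p) = T * (1 - p)) : S = T := by
  refine DFunLike.coe_injective
    ((denseRange_apply_add_apply_one_sub hp).equalizer S.continuous T.continuous ?_)
  ext v
  have h1 := apply_apply_of_mul_eq h v.1
  have h2 := apply_apply_of_mul_eq h' v.2
  simp only [mul_apply] at h1 h2
  simp only [Function.comp_apply, map_add, h1, h2]

/-- The map `X u ↦ Y u` extends to a bounded operator that vanishes on the complement of the
closure of `𝓡(X)`. -/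
theorem exists_continuousLinearMap_extension [CompleteSpace E] (h : star X * X = star Y * Y)
    (hp : IsProjectionOnto p (closure (opRange X))) :
    ∃ U : E →L[ℂ] E, ∀ u v : E, U (X u + (1 - p) v) = Y u := by
  let e : E × E →ₗ[ℂ] E :=
    X.toCLM.toLinearMap ∘ₗ LinearMap.fst ℂ E E + (1 - p).toCLM.toLinearMap ∘ₗ LinearMap.snd ℂ E E
  let f : E × E →ₗ[ℂ] E := Y.toCLM.toLinearMap ∘ₗ LinearMap.fst ℂ E E
  have he : DenseRange e := denseRange_apply_add_apply_one_sub hp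
  have hpX : ∀ u, p (X u) = X u := apply_apply_of_mul_eq (mul_eq_of_isProjectionOnto hp)
  have hpp : ∀ v, p (p v) = p v := apply_apply_of_mul_eq hp.1.isIdempotentElem
  -- Applying `p` recovers `X u` from `X u + (1 - p) v`, so this bound gives both well-definedness
  -- and continuity.
  have hb : ∀ v, ‖f v‖ ≤ ‖p‖ * ‖e v‖ := by
    intro v
    have h1 : p (e v) = X v.1 := by
      change p (X v.1 + (v.2 - p v.2)) = _
      rw [map_add, map_sub, hpX, hpp, sub_self, add_zero]
    calc ‖f v‖ = ‖X v.1‖ := norm_apply_eq_of_star_mul_self_eq h v.1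
      _ = ‖p (e v)‖ := by rw [h1]
      _ ≤ _ := norm_apply_le _ _
  exact ⟨f.extendOfNorm e, fun u v => LinearMap.extendOfNorm_eq he ⟨_, hb⟩ (u, v)⟩

variable [StarOrderedRing A]

/-- `T` is a norm limit of operators `T T⋆ R`; no complement of the closed range is needed. -/
theorem opRange_subset_closure_opRange_mul_star [CompleteSpace E] (T : Adjointable A E) :
    opRange T ⊆ closure (opRange (T * star T)) := by
  rintro _ ⟨x, rfl⟩
  rw [Metric.mem_closure_iff]
  intro ε hε
  set δ : ℝ := ε / (‖x‖ + 1) with hδ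
  have hδ0 : 0 < δ := by positivity
  obtain ⟨R, hR⟩ := exists_norm_sub_mul_star_mul_le T (t := δ ^ 2) (by positivity)
  refine ⟨_, ⟨R x, rfl⟩, ?_⟩
  have hR' : ‖T - T * star T * R‖ ≤ δ := le_of_sq_le_sq hR hδ0.le
  calc dist (T x) ((T * star T) (R x)) = ‖(T - T * star T * R) x‖ := by
        rw [dist_eq_norm]; rfl
    _ ≤ ‖T - T * star T * R‖ * ‖x‖ := norm_apply_le _ x
    _ ≤ δ * ‖x‖ := by gcongr
    _ < δ * (‖x‖ + 1) := by nlinarith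
    _ = ε := by rw [hδ]; field_simp

/-! ### Existence of polar decompositions -/

section IsometricExtension

variable [CompleteSpace E] {X Y p : Adjointable A E}

/-- A bounded operator on a Hilbert module may lack an adjoint. Here `q` supplies one: the extension
`V` of `Y u ↦ X u` is adjoint to `U`, as checked on the two dense sums, where the cross terms vanish
by orthogonality. -/
theorem exists_extension {q : Adjointable A E} (h : star X * X = star Y * Y)
    (hp : IsProjectionOnto p (closure (opRange X)))
    (hq : IsProjectionOnto q (closure (opRange Y))) :
    ∃ U : Adjointable A E, U * X = Y ∧ U * (1 - p) = 0 ∧ star U * Y = X := by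
  obtain ⟨U, hU⟩ := exists_continuousLinearMap_extension h hp
  obtain ⟨V, hV⟩ := exists_continuousLinearMap_extension h.symm hq
  have horth : ∀ {Z r : Adjointable A E}, IsProjectionOnto r (closure (opRange Z)) →
      ∀ u v : E, inner A (Z u) ((1 - r) v) = 0 := by
    intro Z r hr u v
    have h1 : star Z * (1 - r) = 0 := by
      rw [← star_star (star Z * (1 - r)), star_mul, star_star, star_sub, star_one,
        hr.1.isSelfAdjoint.star_eq, sub_mul, one_mul, mul_eq_of_isProjectionOnto hr, sub_self,
        star_zero]
    rw [inner_apply_left, ← mul_apply, h1, zero_apply, CStarModule.inner_zero_right]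
  have hadj : ∀ x y : E, inner A (U x) y = inner A x (V y) := by
    intro x y
    have hcont : Continuous fun z : E × E => inner A z.1 z.2 := CStarModule.continuous_inner
    refine (denseRange_apply_add_apply_one_sub hp).induction_on x
      (isClosed_eq (hcont.comp (U.continuous.prodMk continuous_const))
        (hcont.comp (continuous_id.prodMk continuous_const))) fun u => ?_
    refine (denseRange_apply_add_apply_one_sub hq).induction_on y
      (isClosed_eq (hcont.comp (continuous_const.prodMk continuous_id))
        (hcont.comp (continuous_const.prodMk V.continuous))) fun v => ?_
    have h2 : inner A ((1 - p) u.2) (X v.1) = 0 := by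
      rw [← CStarModule.star_inner, horth hp, star_zero]
    rw [hU, hV, CStarModule.inner_add_right, CStarModule.inner_add_left, horth hq, h2,
      inner_apply_left, inner_apply_left, ← mul_apply, ← mul_apply, h]
  let W : Adjointable A E := ⟨U, V, hadj⟩
  let W' : Adjointable A E := ⟨V, U, fun x y => by
    rw [← CStarModule.star_inner, ← hadj, CStarModule.star_inner]⟩
  have hW : star W = W' := star_eq_of_inner hadj
  refine ⟨W, ext fun u => ?_, ext fun v => ?_, ?_⟩
  · have := hU u 0
    rwa [show (1 - p) (0 : E) = 0 from (1 - p).toCLM.map_zero, add_zero] at this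
  · have := hU 0 v
    rwa [show X (0 : E) = 0 from X.toCLM.map_zero, show Y (0 : E) = 0 from Y.toCLM.map_zero,
      zero_add] at this
  · rw [hW]
    ext u
    have := hV u 0
    rwa [show (1 - q) (0 : E) = 0 from (1 - q).toCLM.map_zero, add_zero] at this

/-- An operator has the polar decomposition if the closures of its range and of the range of its
adjoint are ranges of projections. -/
theorem hasPolarDecomposition_of_isProjectionOnto {T p q : Adjointable A E}
    (hp : IsProjectionOnto p (closure (opRange (star T))))
    (hq : IsProjectionOnto q (closure (opRange T))) : HasPolarDecomposition T := by
  set B := CFC.abs T with hB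
  have hBB : B * B = star T * T := CFC.abs_mul_abs T
  have hBs : star B = B := (IsSelfAdjoint.of_nonneg (CFC.abs_nonneg T)).star_eq
  have hTp : T * (1 - p) = 0 := by
    rw [← star_star (T * (1 - p)), star_mul, star_sub, star_one, hp.1.isSelfAdjoint.star_eq,
      sub_mul, one_mul, mul_eq_of_isProjectionOnto hp, sub_self, star_zero]
  have hBp : B * (1 - p) = 0 := by
    rw [← CStarRing.star_mul_self_eq_zero_iff, star_mul, hBs]
    calc star (1 - p) * B * (B * (1 - p)) = star (1 - p) * (B * B) * (1 - p) := by noncomm_ring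
      _ = star (1 - p) * star T * (T * (1 - p)) := by rw [hBB]; noncomm_ring
      _ = 0 := by rw [hTp, mul_zero]
  have hpB : p * B = B := by
    have := congrArg star hBp
    rw [star_mul, hBs, star_sub, star_one, hp.1.isSelfAdjoint.star_eq, star_zero, sub_mul,
      one_mul, sub_eq_zero] at this
    exact this.symm
  -- `T⋆ = T⋆ q` and `q x` is a limit of vectors `T y`, for which `T⋆ T y = B (B y)`; conversely `B
  -- = p B`.
  have hcl : closure (opRange (star T)) = closure (opRange B) := by
    refine (closure_minimal ?_ isClosed_closure).antisymm (closure_minimal ?_ isClosed_closure)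
    · rintro _ ⟨x, rfl⟩
      have hTT : ∀ y, ∃ z, B z = star T (T y) := fun y =>
        ⟨B y, by rw [← mul_apply, hBB, mul_apply]⟩
      have hx : star T (q x) ∈ closure (opRange B) :=
        apply_mem_closure_opRange hTT (hq.2 ▸ ⟨x, rfl⟩)
      have hTq : star T * q = star T := by
        rw [← star_star (star T * q), star_mul, star_star, hq.1.isSelfAdjoint.star_eq,
          mul_eq_of_isProjectionOnto hq]
      rwa [apply_apply_of_mul_eq hTq] at hx
    · rintro _ ⟨x, rfl⟩
      rw [← hp.2, ← hpB]
      exact ⟨B x, rfl⟩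
  have hp' : IsProjectionOnto p (closure (opRange B)) := hcl ▸ hp
  obtain ⟨U, hUB, hUp, hUT⟩ := exists_extension (X := B) (Y := T) (by rw [hBs, hBB]) hp' hq
  have hUU : star U * U = p := by
    refine eq_of_mul_eq_of_mul_one_sub_eq hp' ?_ ?_
    · rw [mul_assoc, hUB, hUT, hpB]
    · rw [mul_assoc, hUp, mul_zero, mul_sub, mul_one, hp.1.isIdempotentElem.eq, sub_self]
  refine ⟨U, ?_, hUB.symm, hUU ▸ hp⟩
  rw [mul_assoc, hUU]
  rw [mul_sub, mul_one, sub_eq_zero] at hUp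
  exact hUp.symm

end IsometricExtension

end Adjointable

open Adjointable

/-! ### Algebra of quasi-projection pairs -/

namespace IsQuasiProjectionPair

variable {A E : Type*} [NonUnitalCStarAlgebra A] [PartialOrder A]
  [NormedAddCommGroup E] [NormedSpace ℂ E] [SMul A E] [CStarModule A E]
  {P Q : Adjointable A E}

/-- The symmetry `2P - 1` acts as `1` on `𝓡(P)` and `-1` on `𝓡(1 - P)`, so conjugation by it changes
the sign of the off-diagonal corners only. -/
theorem of_star_eq (hP : IsStarProjection P) (hQ : IsIdempotentElem Q)
    (h : star Q = (2 * P - 1) * Q * (2 * P - 1)) : IsQuasiProjectionPair P Q := by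
  have hPP : P * P = P := hP.isIdempotentElem
  have h1 : P * (2 * P - 1) = P := by
    rw [show P * (2 * P - 1) = 2 * (P * P) - P by noncomm_ring, hPP]; noncomm_ring
  have h2 : (2 * P - 1) * P = P := by
    rw [show (2 * P - 1) * P = 2 * (P * P) - P by noncomm_ring, hPP]; noncomm_ring
  have h3 : (1 - P) * (2 * P - 1) = -(1 - P) := by
    rw [sub_mul, h1]; noncomm_ring
  have h4 : (2 * P - 1) * (1 - P) = -(1 - P) := by
    rw [mul_sub, h2]; noncomm_ring
  refine ⟨hP, hQ, ?_, ?_, ?_⟩ <;> rw [h]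
  · calc P * ((2 * P - 1) * Q * (2 * P - 1)) * P
        = (P * (2 * P - 1)) * Q * ((2 * P - 1) * P) := by simp only [mul_assoc]
      _ = _ := by rw [h1, h2]
  · calc P * ((2 * P - 1) * Q * (2 * P - 1)) * (1 - P)
        = (P * (2 * P - 1)) * Q * ((2 * P - 1) * (1 - P)) := by simp only [mul_assoc]
      _ = _ := by rw [h1, h4, mul_neg]
  · calc (1 - P) * ((2 * P - 1) * Q * (2 * P - 1)) * (1 - P)
        = ((1 - P) * (2 * P - 1)) * Q * ((2 * P - 1) * (1 - P)) := by simp only [mul_assoc]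
      _ = _ := by rw [h3, h4, mul_neg, neg_mul, neg_mul, neg_neg]


/-- Sum of the four corners of `Q⋆`; the one not covered by the definition is obtained from the
adjoint of `off_diagonal`. -/
theorem star_eq (h : IsQuasiProjectionPair P Q) : star Q = (2 * P - 1) * Q * (2 * P - 1) := by
  have hPs : star P = P := h.isStarProjection.isSelfAdjoint.star_eq
  have h3 : (1 - P) * star Q * P = -((1 - P) * Q * P) := by
    have := congrArg star h.off_diagonal
    simp only [star_mul, star_neg, star_sub, star_one, star_star, hPs] at this
    rw [← neg_eq_iff_eq_neg, mul_assoc, ← this, mul_assoc]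
  calc star Q = P * star Q * P + P * star Q * (1 - P) + (1 - P) * star Q * P
        + (1 - P) * star Q * (1 - P) := by noncomm_ring
    _ = P * Q * P + -(P * Q * (1 - P)) + -((1 - P) * Q * P) + (1 - P) * Q * (1 - P) := by
        rw [h.corner, h.off_diagonal, h.co_corner, h3]
    _ = _ := by noncomm_ring

theorem symmetry_mul_self (h : IsQuasiProjectionPair P Q) :
    (2 * P - 1) * (2 * P - 1) = 1 := by
  have hPP : P * P = P := h.isStarProjection.isIdempotentElem
  rw [show (2 * P - 1) * (2 * P - 1) = 4 * (P * P) - 4 * P + 1 by noncomm_ring, hPP]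
  noncomm_ring

/-- Passing to complements replaces `2P - 1` by its negative, which conjugates in the same way. -/
theorem one_sub (h : IsQuasiProjectionPair P Q) : IsQuasiProjectionPair (1 - P) (1 - Q) := by
  refine of_star_eq h.isStarProjection.one_sub h.isIdempotentElem.one_sub ?_
  rw [star_sub, star_one, h.star_eq, show 2 * (1 - P) - 1 = -(2 * P - 1) by noncomm_ring,
    neg_mul, neg_mul_neg, mul_sub (2 * P - 1), sub_mul _ _ (2 * P - 1), mul_one,
    h.symmetry_mul_self]

theorem commute_fst (h : IsQuasiProjectionPair P Q) : Commute ((P - Q) * (P - Q)) P := by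
  have hPP : P * P = P := h.isStarProjection.isIdempotentElem
  have hP' : ∀ x, P * (P * x) = P * x := fun x => by rw [← mul_assoc, hPP]
  have hQQ : Q * Q = Q := h.isIdempotentElem
  change _ * _ = _ * _
  simp only [mul_sub, sub_mul, mul_assoc, hPP, hP', hQQ]
  abel

theorem commute_snd (h : IsQuasiProjectionPair P Q) : Commute ((P - Q) * (P - Q)) Q := by
  have hPP : P * P = P := h.isStarProjection.isIdempotentElem
  have hQQ : Q * Q = Q := h.isIdempotentElem
  have hQ' : ∀ x, Q * (Q * x) = Q * x := fun x => by rw [← mul_assoc, hQQ]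
  change _ * _ = _ * _
  simp only [mul_sub, sub_mul, mul_assoc, hPP, hQQ, hQ']
  abel

theorem fst_mul_one_sub_mul_fst (h : IsQuasiProjectionPair P Q) :
    P * (1 - Q) * P = P * ((P - Q) * (P - Q)) := by
  have hPP : P * P = P := h.isStarProjection.isIdempotentElem
  have hP' : ∀ x, P * (P * x) = P * x := fun x => by rw [← mul_assoc, hPP]
  have hQQ : Q * Q = Q := h.isIdempotentElem
  simp only [mul_sub, sub_mul, mul_assoc, mul_one, hPP, hP', hQQ]
  abel

theorem one_sub_mul_fst_mul_one_sub (h : IsQuasiProjectionPair P Q) :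
    (1 - Q) * P * (1 - Q) = (P - Q) * (P - Q) * (1 - Q) := by
  have hPP : P * P = P := h.isStarProjection.isIdempotentElem
  have hQQ : Q * Q = Q := h.isIdempotentElem
  simp only [mul_sub, sub_mul, mul_assoc, mul_one, one_mul, hPP, hQQ]
  abel

theorem star_sub_eq (h : IsQuasiProjectionPair P Q) :
    star (P - Q) = (2 * P - 1) * (P - Q) * (2 * P - 1) := by
  have hPP : P * P = P := h.isStarProjection.isIdempotentElem
  have hP : (2 * P - 1) * P * (2 * P - 1) = P := by
    rw [show (2 * P - 1) * P * (2 * P - 1) = 4 * (P * P * P) - 4 * (P * P) + P by noncomm_ring,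
      hPP, hPP]
    noncomm_ring
  rw [mul_sub (2 * P - 1), sub_mul _ _ (2 * P - 1), hP, ← h.star_eq, star_sub, h.isStarProjection.isSelfAdjoint.star_eq]

/-- The adjoint is the conjugate of `(P - Q)²` by `2P - 1`, with which it commutes. -/
theorem isSelfAdjoint_sub_mul_sub (h : IsQuasiProjectionPair P Q) :
    IsSelfAdjoint ((P - Q) * (P - Q)) := by
  have hc : Commute ((P - Q) * (P - Q)) (2 * P - 1) :=
    ((Commute.ofNat_right _ 2).mul_right h.commute_fst).sub_right (Commute.one_right _)
  change star _ = _
  rw [star_mul, h.star_sub_eq]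
  calc (2 * P - 1) * (P - Q) * (2 * P - 1) * ((2 * P - 1) * (P - Q) * (2 * P - 1))
      = (2 * P - 1) * (P - Q) * ((2 * P - 1) * (2 * P - 1)) * ((P - Q) * (2 * P - 1)) := by
        simp only [mul_assoc]
    _ = (2 * P - 1) * ((P - Q) * (P - Q) * (2 * P - 1)) := by
        rw [h.symmetry_mul_self, mul_one]; simp only [mul_assoc]
    _ = _ := by rw [hc.eq, ← mul_assoc, h.symmetry_mul_self, one_mul]

/-- Idempotency gives `(2P - 1)(P - Q) = (P - Q)(1 - 2Q)`, which moves both factors `P - Q` to the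
left. -/
theorem sub_mul_star_sub (h : IsQuasiProjectionPair P Q) :
    (P - Q) * star (P - Q) = (P - Q) * (P - Q) * ((1 - 2 * Q) * (2 * P - 1)) := by
  have hPP : P * P = P := h.isStarProjection.isIdempotentElem
  have hQQ : Q * Q = Q := h.isIdempotentElem
  have h1 : (2 * P - 1) * (P - Q) = (P - Q) * (1 - 2 * Q) := by
    rw [show (2 * P - 1) * (P - Q) = 2 * (P * P) - 2 * (P * Q) - P + Q by noncomm_ring,
      show (P - Q) * (1 - 2 * Q) = P - 2 * (P * Q) - Q + 2 * (Q * Q) by noncomm_ring, hPP, hQQ]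
    noncomm_ring
  rw [h.star_sub_eq, h1]
  simp only [mul_assoc]

variable [StarOrderedRing A] [CompleteSpace E]

theorem closure_opRange_sub (h : IsQuasiProjectionPair P Q) :
    closure (opRange (P - Q)) = closure (opRange ((P - Q) * (P - Q))) := by
  refine (closure_minimal ?_ isClosed_closure).antisymm (closure_mono ?_)
  · refine (opRange_subset_closure_opRange_mul_star _).trans (closure_mono ?_)
    rw [h.sub_mul_star_sub]
    rintro _ ⟨x, rfl⟩
    exact ⟨_, rfl⟩
  · rintro _ ⟨x, rfl⟩
    exact ⟨_, rfl⟩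

theorem hasPolarDecomposition_fst (h : IsQuasiProjectionPair P Q)
    (hd : ∀ x, x ∈ closure (opRange ((P - Q) * (P - Q)))) :
    HasPolarDecomposition (P * (1 - Q)) := by
  set D := (P - Q) * (P - Q) with hD
  set e : Adjointable A E := star (1 - Q) with he
  have hes : star e = 1 - Q := star_star _
  have hee : IsIdempotentElem e := h.isIdempotentElem.one_sub.star
  have hstar : star (P * (1 - Q)) = e * P := by
    rw [star_mul, h.isStarProjection.isSelfAdjoint.star_eq]
  -- `e` is only idempotent, so a projection with the same range takes its place.
  obtain ⟨p, hp, hpe, hep⟩ := exists_isStarProjection_of_isIdempotentElem hee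
  have hpr : opRange p = opRange e := by
    ext x
    constructor
    · rintro ⟨y, rfl⟩
      exact ⟨p y, apply_apply_of_mul_eq hep y⟩
    · rintro ⟨y, rfl⟩
      exact ⟨e y, apply_apply_of_mul_eq hpe y⟩
  refine hasPolarDecomposition_of_isProjectionOnto (p := p) (q := P) ⟨hp, ?_⟩
    ⟨h.isStarProjection, ?_⟩
  · rw [hpr, hstar]
    refine Set.Subset.antisymm ?_
      (closure_minimal ?_ (isClosed_opRange_of_isIdempotentElem hee))
    · rintro _ ⟨x, rfl⟩
      refine apply_mem_closure_opRange (R := D) (fun y => ⟨e y, ?_⟩) (hd x)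
      -- Taking adjoints moves `D` to the right, so `e (D y)` equals `T₁⋆ (e y)`.
      have h1 : e * P * e = e * D := by
        have := congrArg star h.one_sub_mul_fst_mul_one_sub
        rw [star_mul, star_mul, star_mul, h.isSelfAdjoint_sub_mul_sub.star_eq,
          h.isStarProjection.isSelfAdjoint.star_eq] at this
        rw [mul_assoc]
        exact this
      rw [apply_apply_of_mul_eq h1, mul_apply]
    · rintro _ ⟨x, rfl⟩
      exact ⟨P x, rfl⟩
  · refine Set.Subset.antisymm ?_ (closure_minimal ?_
      (isClosed_opRange_of_isIdempotentElem h.isStarProjection.isIdempotentElem))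
    · rintro _ ⟨x, rfl⟩
      refine apply_mem_closure_opRange (R := D) (fun y => ⟨P y, ?_⟩) (hd x)
      rw [apply_apply_of_mul_eq h.fst_mul_one_sub_mul_fst, mul_apply]
    · rintro _ ⟨x, rfl⟩
      exact ⟨(1 - Q) x, rfl⟩

theorem isSemiHarmoniousPair (h : IsQuasiProjectionPair P Q)
    (hd : ∀ x, x ∈ closure (opRange ((P - Q) * (P - Q)))) : IsSemiHarmoniousPair P Q := by
  refine ⟨h, h.hasPolarDecomposition_fst hd, ?_⟩
  have := h.one_sub.hasPolarDecomposition_fst fun x => by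
    rw [show (1 - P - (1 - Q)) * (1 - P - (1 - Q)) = (P - Q) * (P - Q) by noncomm_ring]
    exact hd x
  rwa [sub_sub_cancel] at this

end IsQuasiProjectionPair

/-! ### Restriction to closed submodules -/

section Restriction

variable {A E : Type*} [NonUnitalCStarAlgebra A] [PartialOrder A]
  [NormedAddCommGroup E] [NormedSpace ℂ E] [SMul A E] [CStarModule A E]

/-- `SMul A E` carries no module axioms; distributivity comes from nondegeneracy of the inner
product. -/
theorem algebra_smul_sub (a : A) (x y : E) : a • (x - y) = a • x - a • y :=
  CStarModule.eq_of_inner_left_eq (A := A) fun z => by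
    simp only [CStarModule.inner_op_smul_right, CStarModule.inner_sub_right, mul_sub]

theorem continuous_algebra_smul (a : A) : Continuous fun x : E => a • x := by
  have hle : ∀ x : E, ‖a • x‖ ≤ ‖a‖ * ‖x‖ := by
    intro x
    refine (sq_le_sq₀ (norm_nonneg _) (by positivity)).mp ?_
    rw [CStarModule.norm_sq_eq (A := A), CStarModule.inner_op_smul_right,
      CStarModule.inner_op_smul_left, mul_pow, CStarModule.norm_sq_eq (A := A) (x := x)]
    calc ‖a * (inner A x x * star a)‖ ≤ ‖a‖ * (‖inner A x x‖ * ‖star a‖) :=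
          (norm_mul_le _ _).trans (by gcongr; exact norm_mul_le _ _)
      _ = ‖a‖ ^ 2 * ‖inner A x x‖ := by rw [norm_star]; ring
  refine LipschitzWith.continuous (K := ‖a‖₊) (LipschitzWith.of_dist_le_mul fun x y => ?_)
  rw [dist_eq_norm, dist_eq_norm, ← algebra_smul_sub]
  exact hle _

/-- The closure of the range of an adjointable operator, as a closed submodule. -/
def Adjointable.closureRange (T : Adjointable A E) : HilbertSubmodule A E where
  toSubmodule := (LinearMap.range T.toCLM.toLinearMap).topologicalClosure
  algebra_smul_mem' a {x} hx := by
    change x ∈ closure (Set.range T) at hx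
    change a • x ∈ closure (Set.range T)
    refine closure_minimal (t := (fun x : E => a • x) ⁻¹' closure (Set.range T)) ?_
      (isClosed_closure.preimage (continuous_algebra_smul a)) hx
    rintro _ ⟨y, rfl⟩
    exact subset_closure ⟨a • y, Adjointable.map_smul T a y⟩
  isClosed' := isClosed_closure

theorem Adjointable.coe_closureRange (T : Adjointable A E) :
    (T.closureRange.toSubmodule : Set E) = closure (opRange T) := rfl

variable {M : HilbertSubmodule A E} {S T : Adjointable A E} {S' T' : Adjointable A M.toSubmodule}

/-- Invariance under `T⋆` provides the adjoint on `M`. -/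
theorem exists_isRestriction (hT : ∀ x ∈ M.toSubmodule, T x ∈ M.toSubmodule)
    (hT' : ∀ x ∈ M.toSubmodule, star T x ∈ M.toSubmodule) :
    ∃ R : Adjointable A M.toSubmodule, IsRestriction T R :=
  ⟨⟨(T.toCLM.comp M.toSubmodule.subtypeL).codRestrict M.toSubmodule fun x => hT x x.2,
    ((star T).toCLM.comp M.toSubmodule.subtypeL).codRestrict M.toSubmodule fun x => hT' x x.2,
    fun x y => inner_apply_left T (x : E) y⟩, fun _ => rfl⟩

namespace IsRestriction

theorem eq (h : IsRestriction T S') (h' : IsRestriction T T') : S' = T' :=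
  Adjointable.ext fun x => Subtype.ext ((h x).trans (h' x).symm)

theorem mul (hS : IsRestriction S S') (hT : IsRestriction T T') :
    IsRestriction (S * T) (S' * T') := fun x => by
  rw [Adjointable.mul_apply, Adjointable.mul_apply, hS, hT]

theorem sub (hS : IsRestriction S S') (hT : IsRestriction T T') :
    IsRestriction (S - T) (S' - T') := fun x => by
  rw [Adjointable.sub_apply, Adjointable.sub_apply, Submodule.coe_sub, hS, hT]

theorem neg (hT : IsRestriction T T') : IsRestriction (-T) (-T') := fun x => by
  rw [Adjointable.neg_apply, Adjointable.neg_apply, Submodule.coe_neg, hT]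

theorem one : IsRestriction (1 : Adjointable A E) (1 : Adjointable A M.toSubmodule) :=
  fun _ => rfl

theorem star (hT : IsRestriction T T') (hs : ∀ x ∈ M.toSubmodule, star T x ∈ M.toSubmodule) :
    IsRestriction (star T) (star T') := by
  intro x
  have : (Star.star T') x = ⟨Star.star T x, hs x x.2⟩ := by
    refine CStarModule.eq_of_inner_left_eq (A := A) fun y => ?_
    rw [← inner_apply_left]
    change inner A ((T' y : M.toSubmodule) : E) (x : E) = inner A (y : E) (Star.star T x)
    rw [hT, inner_apply_left]
  rw [this]

theorem isQuasiProjectionPair {P Q : Adjointable A E} {P' Q' : Adjointable A M.toSubmodule}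
    (h : IsQuasiProjectionPair P Q) (hP : IsRestriction P P') (hQ : IsRestriction Q Q')
    (hPs : IsRestriction (Star.star P) (Star.star P'))
    (hQs : IsRestriction (Star.star Q) (Star.star Q')) : IsQuasiProjectionPair P' Q' where
  isStarProjection := by
    refine ⟨(hP.mul hP).eq ?_, hPs.eq ?_⟩
    · rwa [h.isStarProjection.isIdempotentElem.eq]
    · rwa [h.isStarProjection.isSelfAdjoint.star_eq]
  isIdempotentElem := (hQ.mul hQ).eq (by rwa [h.isIdempotentElem.eq])
  corner := ((hP.mul hQs).mul hP).eq (by rw [h.corner]; exact (hP.mul hQ).mul hP)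
  off_diagonal := ((hP.mul hQs).mul (one.sub hP)).eq (by
    rw [h.off_diagonal]; exact ((hP.mul hQ).mul (one.sub hP)).neg)
  co_corner := (((one.sub hP).mul hQs).mul (one.sub hP)).eq (by
    rw [h.co_corner]; exact ((one.sub hP).mul hQ).mul (one.sub hP))

end IsRestriction

end Restriction

/-! ### The main theorem -/

open scoped Pointwise in
theorem mainTheorem8 {A E : Type*}
    [NonUnitalCStarAlgebra A] [PartialOrder A] [StarOrderedRing A]
    [NormedAddCommGroup E] [NormedSpace ℂ E] [CompleteSpace E] [SMul A E] [CStarModule A E]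
    (P Q : Adjointable A E) (hPQ : IsQuasiProjectionPair P Q) :
    ∃ M : HilbertSubmodule A E,
      (M.toSubmodule : Set E) =
          closure (opRange (P * (1 - Q))) + closure (opRange ((1 - P) * Q)) ∧
      (M.toSubmodule : Set E) = closure (opRange (P - Q)) ∧
      ∃ P' Q' : Adjointable A M.toSubmodule,
        IsRestriction P P' ∧ IsRestriction Q Q' ∧ IsSemiHarmoniousPair P' Q' := by
  have hPP : P * P = P := hPQ.isStarProjection.isIdempotentElem
  set X := P - Q with hX
  set D := X * X with hD
  have hDs : star D = D := hPQ.isSelfAdjoint_sub_mul_sub.star_eq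
  have hinv : ∀ T : Adjointable A E, Commute D T → ∀ x ∈ closure (opRange D),
      T x ∈ closure (opRange D) := by
    intro T hT x hx
    refine apply_mem_closure_opRange (R := D) (fun y => ⟨T y, ?_⟩) hx
    rw [← mul_apply, hT.eq, mul_apply]
  have hXD : closure (opRange X) = closure (opRange D) := hPQ.closure_opRange_sub
  have hPX : P * X = P * (1 - Q) := by rw [hX, mul_sub, hPP, mul_sub, mul_one]
  have hPX' : (1 - P) * X = -((1 - P) * Q) := by
    rw [hX, mul_sub, sub_mul 1 P P, hPP, one_mul, sub_self, zero_sub]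
  have hP_mem := hinv P hPQ.commute_fst
  have hQ_mem := hinv Q hPQ.commute_snd
  have hPs_mem : ∀ x ∈ closure (opRange D), star P x ∈ closure (opRange D) := by
    rwa [hPQ.isStarProjection.isSelfAdjoint.star_eq]
  have hQs_mem : ∀ x ∈ closure (opRange D), star Q x ∈ closure (opRange D) := by
    refine hinv (star Q) ?_
    have := hPQ.commute_snd.star_star
    rwa [← hX, ← hD, hDs] at this
  have h1P_mem := hinv (1 - P) ((Commute.one_right D).sub_right hPQ.commute_fst)
  -- Taking the closure of `𝓡(D)` as `M` makes invariance immediate from commutation with `D`.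
  refine ⟨D.closureRange, ?_, hXD.symm, ?_⟩
  · rw [coe_closureRange]
    refine Set.Subset.antisymm (fun x hx => ?_) ?_
    -- The summands of `x = P x + (1 - P) x` land in the right closures because `P X = T₁` and `(1 -
    -- P) X = -T₂`.
    · refine Set.mem_add.2 ⟨P x, ?_, (1 - P) x, ?_, by simp⟩
      · refine apply_mem_closure_opRange (R := X) (fun y => ⟨y, ?_⟩) (hXD ▸ hx)
        rw [← hPX, mul_apply]
      · refine apply_mem_closure_opRange (R := X) (fun y => ⟨-y, ?_⟩) (hXD ▸ hx)
        rw [← mul_apply, hPX', Adjointable.neg_apply]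
        exact ((1 - P) * Q).toCLM.map_neg y
    · rintro _ ⟨x, hx, y, hy, rfl⟩
      refine D.closureRange.toSubmodule.add_mem ?_ ?_
      · refine closure_minimal ?_ isClosed_closure hx
        rintro _ ⟨z, rfl⟩
        rw [← hPX]
        exact hP_mem _ (hXD ▸ subset_closure ⟨z, rfl⟩)
      · refine closure_minimal ?_ isClosed_closure hy
        rintro _ ⟨z, rfl⟩
        rw [← neg_neg ((1 - P) * Q), ← hPX', Adjointable.neg_apply]
        exact D.closureRange.toSubmodule.neg_mem
          (h1P_mem _ (hXD ▸ subset_closure ⟨z, rfl⟩))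
  · obtain ⟨P', hP'⟩ := exists_isRestriction (M := D.closureRange) hP_mem hPs_mem
    obtain ⟨Q', hQ'⟩ := exists_isRestriction (M := D.closureRange) hQ_mem hQs_mem
    refine ⟨P', Q', hP', hQ', IsQuasiProjectionPair.isSemiHarmoniousPair
      (hP'.isQuasiProjectionPair hPQ hQ' (hP'.star hPs_mem) (hQ'.star hQs_mem)) fun x => ?_⟩
    have hD' : IsRestriction D ((P' - Q') * (P' - Q')) := (hP'.sub hQ').mul (hP'.sub hQ')
    -- Since `D` is self-adjoint, `𝓡(D²)` is dense in `M`; and `D² y = D (D y)` with `D y` in `M`,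
    -- so `D` restricted to `M` has dense range.
    have hx : (x : E) ∈ closure (opRange (D * D)) := by
      refine closure_minimal ?_ isClosed_closure x.2
      have := opRange_subset_closure_opRange_mul_star D
      rwa [hDs] at this
    rw [closure_subtype]
    refine closure_mono ?_ hx
    rintro _ ⟨y, rfl⟩
    have hy : D y ∈ D.closureRange.toSubmodule := subset_closure ⟨y, rfl⟩
    exact ⟨_, ⟨⟨D y, hy⟩, rfl⟩, hD' _⟩
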